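/- Let $d \ge 1$ and $q \ge 1$ be integers, and let $G$ be a finite simple $d$-regular graph with at least one vertex. For a finite simple graph $F$, let $c_q(F)$ denote the number of proper $q$-colorings of $F$, i.e. the number of maps $V(F) \to \{1,\dots,q\}$ that assign different values to the two endpoints of every edge of $F$ (colors are labeled). Let $K_{d,d}$ be the complete bipartite graph with $d$ vertices in each part. Then $$c_q(G)^{1/|V(G)|} \le c_q(K_{d,d})^{1/(2d)}.$$ Since $K_{d,d}$ is itself $d$-regular with $2d$ vertices, this says that $K_{d,d}$ maximizes $c_q(G)^{1/|V(G)|}$ among all finite $d$-regular graphs $G$. -/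

import Mathlib

/-! The theorem is the regular, equal-list case of a bound for list colorings of an arbitrary graph:
their number is at most the product over edges `uv` of N(uv), times the list sizes at isolated
vertices. Here N(uv) is the number of colorings of K_{deg u, deg v} from the lists of `u` and `v`,
raised to the power 1/(deg u · deg v). In a d-regular graph each of the d|V|/2 edges contributes the
same c_q(K_{d,d})^{1/d²}.

The list bound is proved by induction, fixing the color c of a vertex `w` of maximum degree Δ. A
neighbor of `w` loses one degree and the color c, so the factors of its other edges change. If only
one endpoint of an edge is adjacent to `w`, the change is a quotient of biclique norms. If both are
(a triangle), `bicliqueNorm_erase_erase_mul_le` bounds the change by a product of two such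
quotients, one per endpoint; this is why no triangle-free hypothesis is needed.

The sum over c is then split by Hölder, first over the Δ neighbors `v` of `w`, then over the other
neighbors of each `v`. What remains is a moment bound for a single quotient,
`sum_bicliqueNorm_div_pow_le`, whose right-hand sides multiply up to the factors of the edges at
`w`. -/

/-! ### Hölder, Chebyshev and quotients of norms -/

/-- Generalized Hölder: normalize each `f i` to total mass 1 and apply weighted AM-GM at each `a`.
-/
theorem Finset.sum_prod_rpow_le_prod_sum_rpow {ι α : Type*} (s : Finset α) (t : Finset ι)
    (f : ι → α → ℝ) (w : ι → ℝ) (hf : ∀ i ∈ t, ∀ a ∈ s, 0 ≤ f i a) (hw : ∀ i ∈ t, 0 ≤ w i)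
    (hw1 : ∑ i ∈ t, w i = 1) :
    ∑ a ∈ s, ∏ i ∈ t, f i a ^ w i ≤ ∏ i ∈ t, (∑ a ∈ s, f i a) ^ w i := by
  have hS : ∀ i ∈ t, 0 ≤ ∑ a ∈ s, f i a := fun i hi => Finset.sum_nonneg (hf i hi)
  by_cases h : ∃ i ∈ t, ∑ a ∈ s, f i a = 0 ∧ w i ≠ 0
  · obtain ⟨i, hi, hi0, hwi⟩ := h
    rw [Finset.sum_eq_zero]
    · exact Finset.prod_nonneg fun j hj => Real.rpow_nonneg (hS j hj) _
    · intro a ha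
      refine Finset.prod_eq_zero hi ?_
      rw [(Finset.sum_eq_zero_iff_of_nonneg (hf i hi)).1 hi0 a ha, Real.zero_rpow hwi]
  · push Not at h
    have key : ∀ a ∈ s, ∏ i ∈ t, f i a ^ w i =
        (∏ i ∈ t, (∑ a ∈ s, f i a) ^ w i) * ∏ i ∈ t, (f i a / ∑ a ∈ s, f i a) ^ w i := by
      intro a ha
      rw [← Finset.prod_mul_distrib]
      refine Finset.prod_congr rfl fun i hi => ?_
      by_cases h0 : ∑ a ∈ s, f i a = 0
      · simp [h i hi h0]
      · rw [← Real.mul_rpow (hS i hi) (div_nonneg (hf i hi a ha) (hS i hi)), mul_div_cancel₀ _ h0]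
    rw [Finset.sum_congr rfl key, ← Finset.mul_sum]
    refine mul_le_of_le_one_right
      (Finset.prod_nonneg fun j hj => Real.rpow_nonneg (hS j hj) _) ?_
    calc ∑ a ∈ s, ∏ i ∈ t, (f i a / ∑ a ∈ s, f i a) ^ w i
        ≤ ∑ a ∈ s, ∑ i ∈ t, w i * (f i a / ∑ a ∈ s, f i a) :=
          Finset.sum_le_sum fun a ha => Real.geom_mean_le_arith_mean_weighted t w _ hw hw1
            fun i hi => div_nonneg (hf i hi a ha) (hS i hi)
      _ = ∑ i ∈ t, w i * ((∑ a ∈ s, f i a) / ∑ a ∈ s, f i a) := by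
          rw [Finset.sum_comm]
          simp_rw [← Finset.mul_sum, ← Finset.sum_div]
      -- Only an inequality, because a vanishing sum gives 0/0 = 0.
      _ ≤ ∑ i ∈ t, w i * 1 :=
          Finset.sum_le_sum fun i hi => mul_le_mul_of_nonneg_left (div_self_le_one _) (hw i hi)
      _ = 1 := by simpa using hw1

theorem Finset.sum_rpow_mul_rpow_le {α : Type*} (s : Finset α) (f g : α → ℝ) (θ : ℝ)
    (hf : ∀ a ∈ s, 0 ≤ f a) (hg : ∀ a ∈ s, 0 ≤ g a) (h0 : 0 ≤ θ) (h1 : θ ≤ 1) :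
    ∑ a ∈ s, f a ^ θ * g a ^ (1 - θ) ≤ (∑ a ∈ s, f a) ^ θ * (∑ a ∈ s, g a) ^ (1 - θ) := by
  have := Finset.sum_prod_rpow_le_prod_sum_rpow s Finset.univ ![f, g] ![θ, 1 - θ]
    (by simpa [Fin.forall_fin_two] using ⟨hf, hg⟩) (by simp [Fin.forall_fin_two, h0, h1])
    (by simp)
  simpa using this

/-- Weighted Chebyshev sum inequality. -/
theorem Finset.sum_mul_sum_le_sum_mul_sum_of_monovary {α : Type*} (s : Finset α) (p f g : α → ℝ)
    (hp : ∀ a ∈ s, 0 ≤ p a) (hfg : ∀ a ∈ s, ∀ b ∈ s, 0 ≤ (f a - f b) * (g a - g b)) :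
    (∑ a ∈ s, p a * f a) * (∑ a ∈ s, p a * g a) ≤
      (∑ a ∈ s, p a) * ∑ a ∈ s, p a * (f a * g a) := by
  have h : 0 ≤ ∑ a ∈ s, ∑ b ∈ s, p a * p b * ((f a - f b) * (g a - g b)) :=
    Finset.sum_nonneg fun a ha => Finset.sum_nonneg fun b hb =>
      mul_nonneg (mul_nonneg (hp a ha) (hp b hb)) (hfg a ha b hb)
  have e : ∑ a ∈ s, ∑ b ∈ s, p a * p b * ((f a - f b) * (g a - g b)) =
      2 * ((∑ a ∈ s, p a) * ∑ a ∈ s, p a * (f a * g a)) -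
        2 * ((∑ a ∈ s, p a * f a) * (∑ a ∈ s, p a * g a)) := by
    have : ∀ a b, p a * p b * ((f a - f b) * (g a - g b)) =
        p a * (p b * (f b * g b)) + (p a * (f a * g a)) * p b
          - (p a * f a) * (p b * g b) - (p a * g a) * (p b * f b) := fun a b => by ring
    simp_rw [this, Finset.sum_sub_distrib, Finset.sum_add_distrib, ← Finset.mul_sum,
      ← Finset.sum_mul]
    ring
  linarith

/-- For `M ≥ 1`, the quotient of the `ℓ^s` norms of `M - 1` and `M` increases with `s`. -/
theorem Finset.sum_sub_one_pow_rpow_mul_le {α : Type*} (S : Finset α) (M : α → ℝ)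
    (hM : ∀ a ∈ S, 1 ≤ M a) {s : ℕ} (hs : 1 ≤ s) :
    (∑ a ∈ S, (M a - 1) ^ s) ^ (1 / (s : ℝ)) *
        (∑ a ∈ S, M a ^ (s + 1)) ^ (1 / ((s : ℝ) + 1)) ≤
      (∑ a ∈ S, (M a - 1) ^ (s + 1)) ^ (1 / ((s : ℝ) + 1)) *
        (∑ a ∈ S, M a ^ s) ^ (1 / (s : ℝ)) := by
  have hs0 : (0 : ℝ) < s := by exact_mod_cast hs
  -- `r = 1 - 1/M` increases with `M`. With weights `M ^ s`, Chebyshev applied to `r ^ (s + 1)` and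
  -- `M` gives `cheb`, and Hölder between the moments of `r` of orders `s` and `s + 1` gives `jens`.
  set r : α → ℝ := fun a => (M a - 1) / M a with hr
  have hMp : ∀ a ∈ S, 0 < M a := fun a ha => lt_of_lt_of_le one_pos (hM a ha)
  have hr0 : ∀ a ∈ S, 0 ≤ r a := fun a ha =>
    div_nonneg (sub_nonneg.2 (hM a ha)) (hMp a ha).le
  have hrM : ∀ a ∈ S, r a * M a = M a - 1 := fun a ha =>
    div_mul_cancel₀ _ (hMp a ha).ne'
  set X := ∑ a ∈ S, (M a - 1) ^ s with hX
  set X' := ∑ a ∈ S, (M a - 1) ^ (s + 1) with hX'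
  set Y := ∑ a ∈ S, M a ^ s with hY
  set Y' := ∑ a ∈ S, M a ^ (s + 1) with hY'
  set R := ∑ a ∈ S, M a ^ s * r a ^ (s + 1) with hR
  have hX0 : 0 ≤ X := Finset.sum_nonneg fun a ha => pow_nonneg (sub_nonneg.2 (hM a ha)) _
  have hX'0 : 0 ≤ X' := Finset.sum_nonneg fun a ha => pow_nonneg (sub_nonneg.2 (hM a ha)) _
  have hY0 : 0 ≤ Y := Finset.sum_nonneg fun a ha => pow_nonneg (hMp a ha).le _
  have hY'0 : 0 ≤ Y' := Finset.sum_nonneg fun a ha => pow_nonneg (hMp a ha).le _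
  have hR0 : 0 ≤ R := Finset.sum_nonneg fun a ha =>
    mul_nonneg (pow_nonneg (hMp a ha).le _) (pow_nonneg (hr0 a ha) _)
  have cheb : R * Y' ≤ Y * X' := by
    have := Finset.sum_mul_sum_le_sum_mul_sum_of_monovary S (fun a => M a ^ s)
      (fun a => r a ^ (s + 1)) M (fun a ha => pow_nonneg (hMp a ha).le _) (by
        intro a ha b hb
        have hmono : ∀ x ∈ S, ∀ y ∈ S, M x ≤ M y → r x ≤ r y := by
          intro x hx y hy hxy
          simp only [hr]
          rw [div_le_div_iff₀ (hMp x hx) (hMp y hy)]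
          nlinarith
        rcases le_total (M a) (M b) with h | h
        · exact mul_nonneg_of_nonpos_of_nonpos (sub_nonpos.2
            (pow_le_pow_left₀ (hr0 a ha) (hmono a ha b hb h) _)) (sub_nonpos.2 h)
        · exact mul_nonneg (sub_nonneg.2
            (pow_le_pow_left₀ (hr0 b hb) (hmono b hb a ha h) _)) (sub_nonneg.2 h))
    have e1 : ∑ a ∈ S, M a ^ s * M a = Y' := Finset.sum_congr rfl fun a _ => by ring
    have e2 : ∑ a ∈ S, M a ^ s * (r a ^ (s + 1) * M a) = X' :=
      Finset.sum_congr rfl fun a ha => by rw [← hrM a ha, mul_pow, pow_succ (M a)]; ring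
    rwa [e1, e2] at this
  have jens : X ≤ R ^ ((s : ℝ) / (s + 1)) * Y ^ (1 - (s : ℝ) / (s + 1)) := by
    refine le_trans (le_of_eq ?_) (Finset.sum_rpow_mul_rpow_le S (fun a => M a ^ s * r a ^ (s + 1))
      (fun a => M a ^ s) ((s : ℝ) / (s + 1))
      (fun a ha => mul_nonneg (pow_nonneg (hMp a ha).le _) (pow_nonneg (hr0 a ha) _))
      (fun a ha => pow_nonneg (hMp a ha).le _) (by positivity)
      (by rw [div_le_one (by positivity)]; linarith))
    refine Finset.sum_congr rfl fun a ha => ?_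
    rw [Real.mul_rpow (pow_nonneg (hMp a ha).le _) (pow_nonneg (hr0 a ha) _), mul_right_comm,
      ← Real.rpow_add (pow_pos (hMp a ha) _), add_sub_cancel, Real.rpow_one, ← hrM a ha,
      ← Real.rpow_natCast (r a) (s + 1), ← Real.rpow_mul (hr0 a ha), mul_pow]
    push_cast
    rw [mul_div_cancel₀ _ (by positivity), Real.rpow_natCast, mul_comm]
  have e : ∀ x : ℝ, 0 ≤ x → (x ^ ((s : ℝ) / (s + 1))) ^ (1 / (s : ℝ)) = x ^ (1 / ((s : ℝ) + 1)) := by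
    intro x hx
    rw [← Real.rpow_mul hx]
    congr 1
    field_simp
  have e' : (Y ^ (1 - (s : ℝ) / (s + 1))) ^ (1 / (s : ℝ)) * Y ^ (1 / ((s : ℝ) + 1)) =
      Y ^ (1 / (s : ℝ)) := by
    rw [← Real.rpow_mul hY0, ← Real.rpow_add_of_nonneg hY0]
    · congr 1
      field_simp
      ring
    · have : (s : ℝ) / (s + 1) ≤ 1 := by rw [div_le_one (by positivity)]; linarith
      exact mul_nonneg (by linarith) (by positivity)
    · positivity
  calc X ^ (1 / (s : ℝ)) * Y' ^ (1 / ((s : ℝ) + 1))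
      ≤ (R ^ ((s : ℝ) / (s + 1)) * Y ^ (1 - (s : ℝ) / (s + 1))) ^ (1 / (s : ℝ)) *
          Y' ^ (1 / ((s : ℝ) + 1)) := by gcongr
    _ = (R * Y') ^ (1 / ((s : ℝ) + 1)) * (Y ^ (1 - (s : ℝ) / (s + 1))) ^ (1 / (s : ℝ)) := by
        rw [Real.mul_rpow (by positivity) (by positivity), e R hR0, Real.mul_rpow hR0 hY'0]
        ring
    _ ≤ (Y * X') ^ (1 / ((s : ℝ) + 1)) * (Y ^ (1 - (s : ℝ) / (s + 1))) ^ (1 / (s : ℝ)) := by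
        gcongr
    _ = X' ^ (1 / ((s : ℝ) + 1)) * Y ^ (1 / (s : ℝ)) := by
        rw [Real.mul_rpow hY0 hX'0, ← e']
        ring

/-- Multiply `hmono` by the `1 / (s + 1)` power of `hneg`; the powers of `a'` and `b` drop out, the
latter because `b` is positive. -/
theorem rpow_mul_rpow_le_of_chain {a a' b b' x y s : ℝ} (hs : 0 < s) (ha : 0 ≤ a) (ha' : 0 ≤ a')
    (hb : 0 < b) (hb' : 0 ≤ b') (hx : 0 ≤ x) (hy : 0 ≤ y)
    (hmono : a ^ (1 / s) * b ^ (1 / (s + 1)) ≤ a' ^ (1 / (s + 1)) * b' ^ (1 / s))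
    (hneg : a' * x ≤ y * b) {t : ℝ} (ht : 0 < t) :
    a ^ (1 / (s * t)) * x ^ (1 / ((s + 1) * t)) ≤
      b' ^ (1 / (s * t)) * y ^ (1 / ((s + 1) * t)) := by
  have main : a ^ (1 / s) * x ^ (1 / (s + 1)) ≤
      b' ^ (1 / s) * y ^ (1 / (s + 1)) := by
    have h3 := Real.rpow_le_rpow (mul_nonneg ha' hx) hneg
      (show 0 ≤ 1 / (s + 1) by positivity)
    rw [Real.mul_rpow ha' hx, Real.mul_rpow hy hb.le] at h3
    have hbp : 0 < b ^ (1 / (s + 1)) := Real.rpow_pos_of_pos hb _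
    refine le_of_mul_le_mul_right ?_ hbp
    calc a ^ (1 / s) * x ^ (1 / (s + 1)) * b ^ (1 / (s + 1))
        = (a ^ (1 / s) * b ^ (1 / (s + 1))) * x ^ (1 / (s + 1)) := by ring
      _ ≤ (a' ^ (1 / (s + 1)) * b' ^ (1 / s)) * x ^ (1 / (s + 1)) := by
          gcongr
      _ = b' ^ (1 / s) * (a' ^ (1 / (s + 1)) * x ^ (1 / (s + 1))) := by ring
      _ ≤ b' ^ (1 / s) * (y ^ (1 / (s + 1)) * b ^ (1 / (s + 1))) := by
          gcongr
      _ = _ := by ring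
  have hfin := Real.rpow_le_rpow (mul_nonneg (Real.rpow_nonneg ha _) (Real.rpow_nonneg hx _)) main
    (show 0 ≤ 1 / t by positivity)
  rw [Real.mul_rpow (Real.rpow_nonneg ha _) (Real.rpow_nonneg hx _),
    Real.mul_rpow (Real.rpow_nonneg hb' _) (Real.rpow_nonneg hy _),
    ← Real.rpow_mul ha, ← Real.rpow_mul hx, ← Real.rpow_mul hb', ← Real.rpow_mul hy] at hfin
  simpa only [one_div_mul_one_div] using hfin

/-! ### Colorings of complete bipartite graphs with one list per side -/

section Biclique

variable {C : Type*} [DecidableEq C]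

/-- The elements of `A` which are not values of `y`. -/
def avoiding {n : ℕ} (A : Finset C) (y : Fin n → C) : Finset C :=
  A.filter fun x => ∀ j, x ≠ y j

/-- The proper colorings of `K_{s,t}` with colors from `A` on the first side and from `B` on the
second side. -/
def bicliqueColorings (s t : ℕ) (A B : Finset C) : Finset ((Fin s → C) × (Fin t → C)) :=
  (Fintype.piFinset (fun _ => A) ×ˢ Fintype.piFinset (fun _ => B)).filter
    fun z => ∀ i j, z.1 i ≠ z.2 j

def bicliqueCount (s t : ℕ) (A B : Finset C) : ℕ := (bicliqueColorings s t A B).card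

noncomputable def bicliqueNorm (s t : ℕ) (A B : Finset C) : ℝ :=
  (bicliqueCount s t A B : ℝ) ^ (1 / ((s : ℝ) * t))

theorem mem_bicliqueColorings {s t : ℕ} {A B : Finset C} {z : (Fin s → C) × (Fin t → C)} :
    z ∈ bicliqueColorings s t A B ↔
      ((∀ i, z.1 i ∈ A) ∧ ∀ j, z.2 j ∈ B) ∧ ∀ i j, z.1 i ≠ z.2 j := by
  simp [bicliqueColorings]

theorem bicliqueCount_comm (s t : ℕ) (A B : Finset C) :
    bicliqueCount s t A B = bicliqueCount t s B A := by
  refine Finset.card_bij' (fun z _ => z.swap) (fun z _ => z.swap) ?_ ?_ ?_ ?_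
  · intro z hz
    rw [mem_bicliqueColorings] at hz ⊢
    exact ⟨hz.1.symm, fun i j => (hz.2 j i).symm⟩
  · intro z hz
    rw [mem_bicliqueColorings] at hz ⊢
    exact ⟨hz.1.symm, fun i j => (hz.2 j i).symm⟩
  · simp
  · simp

theorem bicliqueNorm_comm (s t : ℕ) (A B : Finset C) :
    bicliqueNorm s t A B = bicliqueNorm t s B A := by
  rw [bicliqueNorm, bicliqueNorm, bicliqueCount_comm, mul_comm]

theorem bicliqueNorm_nonneg (s t : ℕ) (A B : Finset C) : 0 ≤ bicliqueNorm s t A B :=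
  Real.rpow_nonneg (Nat.cast_nonneg _) _

theorem bicliqueCount_eq_sum_left (s t : ℕ) (A B : Finset C) :
    bicliqueCount s t A B =
      ∑ x ∈ Fintype.piFinset (fun _ : Fin s => A), (avoiding B x).card ^ t := by
  rw [bicliqueCount, bicliqueColorings, Finset.card_filter, Finset.sum_product]
  refine Finset.sum_congr rfl fun x _ => ?_
  rw [← Finset.card_filter, ← Fintype.card_piFinset_const]
  congr 1
  ext y
  simp only [avoiding, Finset.mem_filter, Fintype.mem_piFinset]
  exact ⟨fun h j => ⟨h.1 j, fun i => (h.2 i j).symm⟩,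
    fun h => ⟨fun j => (h j).1, fun i j => ((h j).2 i).symm⟩⟩

theorem bicliqueCount_eq_sum_right (s t : ℕ) (A B : Finset C) :
    bicliqueCount s t A B =
      ∑ y ∈ Fintype.piFinset (fun _ : Fin t => B), (avoiding A y).card ^ s := by
  rw [bicliqueCount_comm, bicliqueCount_eq_sum_left]

theorem bicliqueCount_pos {A B : Finset C} {x y : C} (hx : x ∈ A) (hy : y ∈ B) (hxy : x ≠ y)
    (s t : ℕ) : 0 < bicliqueCount s t A B :=
  Finset.card_pos.2 ⟨(fun _ => x, fun _ => y), mem_bicliqueColorings.2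
    ⟨⟨fun _ => hx, fun _ => hy⟩, fun _ _ => hxy⟩⟩

/-- The events that `c` is not used on the first side and that `c` is not used on the second side
are negatively correlated. -/
theorem bicliqueCount_erase_erase_mul_le (s t : ℕ) (A B : Finset C) (c : C) :
    bicliqueCount s t (A.erase c) (B.erase c) * bicliqueCount s t A B ≤
      bicliqueCount s t (A.erase c) B * bicliqueCount s t A (B.erase c) := by
  -- No coloring uses `c` on both sides, so the two events cover everything.
  have hu : bicliqueColorings s t (A.erase c) B ∪ bicliqueColorings s t A (B.erase c) =
      bicliqueColorings s t A B := by
    ext z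
    simp only [Finset.mem_union, mem_bicliqueColorings, Finset.mem_erase]
    constructor
    · rintro (h | h)
      · exact ⟨⟨fun i => (h.1.1 i).2, h.1.2⟩, h.2⟩
      · exact ⟨⟨h.1.1, fun j => (h.1.2 j).2⟩, h.2⟩
    · intro h
      by_cases hc : ∃ i, z.1 i = c
      · obtain ⟨i, hi⟩ := hc
        exact Or.inr ⟨⟨h.1.1, fun j => ⟨fun hj => h.2 i j (hi.trans hj.symm), h.1.2 j⟩⟩, h.2⟩
      · push Not at hc
        exact Or.inl ⟨⟨fun i => ⟨hc i, h.1.1 i⟩, h.1.2⟩, h.2⟩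
  have hi : bicliqueColorings s t (A.erase c) B ∩ bicliqueColorings s t A (B.erase c) =
      bicliqueColorings s t (A.erase c) (B.erase c) := by
    ext z
    simp only [Finset.mem_inter, mem_bicliqueColorings, Finset.mem_erase]
    exact ⟨fun h => ⟨⟨h.1.1.1, h.2.1.2⟩, h.1.2⟩, fun h =>
      ⟨⟨⟨h.1.1, fun j => (h.1.2 j).2⟩, h.2⟩, ⟨⟨fun i => (h.1.1 i).2, h.1.2⟩, h.2⟩⟩⟩
  have hc := Finset.card_union_add_card_inter (bicliqueColorings s t (A.erase c) B)
    (bicliqueColorings s t A (B.erase c))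
  have h1 := Finset.card_le_card (Finset.inter_subset_left
    (s₁ := bicliqueColorings s t (A.erase c) B) (s₂ := bicliqueColorings s t A (B.erase c)))
  have h2 := Finset.card_le_card (Finset.inter_subset_right
    (s₁ := bicliqueColorings s t (A.erase c) B) (s₂ := bicliqueColorings s t A (B.erase c)))
  rw [hu, hi] at hc
  rw [hi] at h1 h2
  simp only [bicliqueCount]
  -- With E, F the two sets, |E ∩ F| |E ∪ F| ≤ |E| |F| amounts to (|E| - |E ∩ F|)(|F| - |E ∩ F|) ≥
  -- 0.
  nlinarith [Nat.mul_le_mul h1 h2]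

/-- For a coloring `y` of the second side avoiding `c ∈ A`, erasing `c` from `A` lowers the number
M(y) of colors available to the first side by exactly 1. Monotonicity of ‖M - 1‖ / ‖M‖ in the
exponent therefore passes from `s` to `s + 1`, where negative correlation finishes. -/
theorem bicliqueNorm_erase_erase_mul_le {s t : ℕ} (hs : 1 ≤ s) (ht : 1 ≤ t) (A B : Finset C)
    (c : C) :
    bicliqueNorm s t (A.erase c) (B.erase c) * bicliqueNorm (s + 1) t A B ≤
      bicliqueNorm s t A (B.erase c) * bicliqueNorm (s + 1) t (A.erase c) B := by
  have hs0 : (0 : ℝ) < s := by exact_mod_cast hs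
  have ht0 : (0 : ℝ) < t := by exact_mod_cast ht
  rcases Nat.eq_zero_or_pos (bicliqueCount (s + 1) t A (B.erase c)) with hzero | hpos
  · have h0 : bicliqueCount s t (A.erase c) (B.erase c) = 0 := by
      by_contra hne
      obtain ⟨z, hz⟩ := Finset.card_pos.1 (Nat.pos_of_ne_zero hne)
      rw [mem_bicliqueColorings] at hz
      exact (bicliqueCount_pos (Finset.mem_of_mem_erase (hz.1.1 ⟨0, hs⟩)) (hz.1.2 ⟨0, ht⟩)
        (hz.2 _ _) (s + 1) t).ne' hzero
    rw [bicliqueNorm, h0, Nat.cast_zero, Real.zero_rpow (by positivity), zero_mul]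
    exact mul_nonneg (bicliqueNorm_nonneg ..) (bicliqueNorm_nonneg ..)
  by_cases hc : c ∈ A
  swap
  · rw [Finset.erase_eq_of_notMem hc]
  have hav : ∀ y ∈ Fintype.piFinset (fun _ : Fin t => B.erase c),
      ((avoiding (A.erase c) y).card : ℝ) = (avoiding A y).card - 1 ∧
        (1 : ℝ) ≤ (avoiding A y).card := by
    intro y hy
    have hmem : c ∈ avoiding A y := by
      simp only [Fintype.mem_piFinset, Finset.mem_erase] at hy
      simp only [avoiding, Finset.mem_filter]
      exact ⟨hc, fun j => (hy j).1.symm⟩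
    have he : avoiding (A.erase c) y = (avoiding A y).erase c := by
      simp [avoiding, Finset.filter_erase]
    have hcard : 1 ≤ (avoiding A y).card := Finset.card_pos.2 ⟨c, hmem⟩
    rw [he, Finset.card_erase_of_mem hmem, Nat.cast_sub hcard]
    exact ⟨by simp, by exact_mod_cast hcard⟩
  have hmono := Finset.sum_sub_one_pow_rpow_mul_le
    (Fintype.piFinset (fun _ : Fin t => B.erase c)) (fun y => ((avoiding A y).card : ℝ))
    (fun y hy => (hav y hy).2) hs
  have e1 : ∀ k : ℕ, ∑ y ∈ Fintype.piFinset (fun _ : Fin t => B.erase c),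
      (((avoiding A y).card : ℝ) - 1) ^ k = bicliqueCount k t (A.erase c) (B.erase c) := by
    intro k
    rw [bicliqueCount_eq_sum_right, Nat.cast_sum]
    exact Finset.sum_congr rfl fun y hy => by rw [← (hav y hy).1, Nat.cast_pow]
  have e2 : ∀ k : ℕ, ∑ y ∈ Fintype.piFinset (fun _ : Fin t => B.erase c),
      ((avoiding A y).card : ℝ) ^ k = bicliqueCount k t A (B.erase c) := by
    intro k
    rw [bicliqueCount_eq_sum_right, Nat.cast_sum]
    exact Finset.sum_congr rfl fun y hy => by rw [Nat.cast_pow]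
  rw [e1, e1, e2, e2] at hmono
  have hneg : (bicliqueCount (s + 1) t (A.erase c) (B.erase c) : ℝ) * bicliqueCount (s + 1) t A B ≤
      bicliqueCount (s + 1) t (A.erase c) B * bicliqueCount (s + 1) t A (B.erase c) := by
    exact_mod_cast bicliqueCount_erase_erase_mul_le (s + 1) t A B c
  simpa only [bicliqueNorm, Nat.cast_add, Nat.cast_one] using
    rpow_mul_rpow_le_of_chain hs0 (Nat.cast_nonneg _) (Nat.cast_nonneg _) (Nat.cast_pos.2 hpos)
      (Nat.cast_nonneg _) (Nat.cast_nonneg _) (Nat.cast_nonneg _) hmono hneg ht0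

/-! ### The moment bound for quotients of biclique norms -/

theorem sum_mul_sum_piFinset_erase (B K : Finset C) {n : ℕ} (τ : C → ℝ) (φ : (Fin n → C) → ℝ) :
    ∑ c ∈ K, τ c * ∑ y ∈ Fintype.piFinset (fun _ : Fin n => B.erase c), φ y =
      ∑ y ∈ Fintype.piFinset (fun _ : Fin n => B), φ y * ∑ c ∈ avoiding K y, τ c := by
  simp only [Finset.mul_sum]
  rw [Finset.sum_comm' (t' := Fintype.piFinset (fun _ : Fin n => B))
    (s' := fun y => avoiding K y)]
  · exact Finset.sum_congr rfl fun y _ => Finset.sum_congr rfl fun c _ => mul_comm _ _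
  · intro c y
    simp only [avoiding, Fintype.mem_piFinset, Finset.mem_erase, Finset.mem_filter]
    exact ⟨fun hc => ⟨⟨hc.1, fun j => (hc.2 j).1.symm⟩, fun j => (hc.2 j).2⟩,
      fun hc => ⟨hc.1.1, fun j => ⟨(hc.1.2 j).symm, hc.2 j⟩⟩⟩

/-- Expand the power and count the pairs `(y, k)` without common values in the other order. -/
theorem sum_sum_avoiding_pow (B K : Finset C) (n m : ℕ) (τ : C → ℝ) :
    ∑ y ∈ Fintype.piFinset (fun _ : Fin n => B), (∑ c ∈ avoiding K y, τ c) ^ m =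
      ∑ k ∈ Fintype.piFinset (fun _ : Fin m => K),
        (∏ j, τ (k j)) * ((avoiding B k).card : ℝ) ^ n := by
  have h1 : ∀ y : Fin n → C, (∑ c ∈ avoiding K y, τ c) ^ m =
      ∑ k ∈ Fintype.piFinset (fun _ : Fin m => avoiding K y), ∏ j, τ (k j) := by
    intro y
    rw [← Finset.prod_univ_sum (fun _ => avoiding K y) (fun _ c => τ c), Finset.prod_const,
      Finset.card_univ, Fintype.card_fin]
  simp only [h1]
  rw [Finset.sum_comm' (t' := Fintype.piFinset (fun _ : Fin m => K))
    (s' := fun k => Fintype.piFinset (fun _ : Fin n => avoiding B k))]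
  · refine Finset.sum_congr rfl fun k _ => ?_
    rw [Finset.sum_const, Fintype.card_piFinset_const, nsmul_eq_mul, mul_comm, Nat.cast_pow]
  · intro y k
    simp only [avoiding, Fintype.mem_piFinset, Finset.mem_filter]
    exact ⟨fun hc => ⟨fun j => ⟨hc.1 j, fun i => ((hc.2 i).2 j).symm⟩, fun i => (hc.2 i).1⟩,
      fun hc => ⟨fun j => (hc.1 j).1, fun i => ⟨hc.2 i, fun j => ((hc.1 j).2 i).symm⟩⟩⟩

/-- A bootstrap: substituting `hGZ` into `hSG` leaves `S ^ (1 - 1 / p)` on the right; cancel it and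
raise to the power `p`. -/
theorem rpow_le_of_le_mul_rpow {S H G Z e p : ℝ} (he : 0 ≤ e) (hp : 1 ≤ p) (hS : 0 ≤ S)
    (hH : 0 ≤ H) (hG : 0 ≤ G) (hZ : 0 ≤ Z)
    (hSG : S ≤ H ^ (e / (e + 1)) * G ^ (1 / (e + 1)))
    (hGZ : G ≤ (S ^ (e + 1)) ^ (1 - 1 / p) * Z ^ (1 / p)) :
    S ≤ H ^ (e / (e + 1) * p) * Z ^ (1 / (e + 1)) := by
  have hp0 : 0 < p := by linarith
  have hd0 : 0 < e + 1 := by positivity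
  rcases hS.eq_or_lt with h0 | hSpos
  · rw [← h0]
    positivity
  have hSp : S ^ (1 / p) ≤ H ^ (e / (e + 1)) * (Z ^ (1 / p)) ^ (1 / (e + 1)) := by
    have hpos : 0 < S ^ (1 - 1 / p) := Real.rpow_pos_of_pos hSpos _
    refine le_of_mul_le_mul_right ?_ hpos
    rw [← Real.rpow_add hSpos, add_sub_cancel, Real.rpow_one]
    calc S ≤ H ^ (e / (e + 1)) * G ^ (1 / (e + 1)) := hSG
      _ ≤ H ^ (e / (e + 1)) * ((S ^ (e + 1)) ^ (1 - 1 / p) * Z ^ (1 / p)) ^ (1 / (e + 1)) := by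
          gcongr
      _ = H ^ (e / (e + 1)) * (S ^ (1 - 1 / p) * (Z ^ (1 / p)) ^ (1 / (e + 1))) := by
          rw [Real.mul_rpow (by positivity) (by positivity), ← Real.rpow_mul hS,
            ← Real.rpow_mul hS]
          congr 3
          field_simp
      _ = _ := by ring
  have := Real.rpow_le_rpow (by positivity) hSp hp0.le
  rw [← Real.rpow_mul hS, one_div_mul_cancel hp0.ne', Real.rpow_one,
    Real.mul_rpow (by positivity) (by positivity), ← Real.rpow_mul hH, ← Real.rpow_mul hZ,
    ← Real.rpow_mul hZ] at this
  refine this.trans (le_of_eq ?_)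
  congr 2
  field_simp

/-- Write T_c for the inner sum, p = Δ/n and S = ∑ T_c^p = ∑ τ_c T_c with τ_c = T_c^{p-1}.
Exchanging summations gives S = ∑_y h(y)^e g(y), where g(y) sums τ over the colors of `K` not in
`y`. Hölder isolates ∑ g^{e+1}; expanded over `(e + 1)`-tuples from `K`, a second Hölder bounds it
by a power of S times a power of the biclique count. Here p ≥ 1, that is `n ≤ Δ`, is essential. -/
theorem sum_sum_erase_pow_rpow_le (B K : Finset C) {e n Δ : ℕ} (hn : 1 ≤ n)
    (hnΔ : n ≤ Δ) (h : (Fin n → C) → ℝ) (hh : ∀ y, 0 ≤ h y) :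
    ∑ c ∈ K, (∑ y ∈ Fintype.piFinset (fun _ : Fin n => B.erase c), h y ^ e) ^ ((Δ : ℝ) / n) ≤
      (∑ y ∈ Fintype.piFinset (fun _ : Fin n => B), h y ^ (e + 1)) ^
          ((e : ℝ) / (e + 1) * (Δ / n)) *
        (bicliqueCount (e + 1) Δ K B : ℝ) ^ (1 / ((e : ℝ) + 1)) := by
  have hn0 : (0 : ℝ) < n := by exact_mod_cast hn
  have hΔ0 : (0 : ℝ) < Δ := by exact_mod_cast hn.trans hnΔ
  have hp1 : 1 ≤ (Δ : ℝ) / n := by rw [one_le_div hn0]; exact_mod_cast hnΔ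
  have hpe : ∀ p : ℝ, p = (Δ : ℝ) / n → p * n = Δ := fun p hp => by
    rw [hp, div_mul_cancel₀ _ hn0.ne']
  generalize (Δ : ℝ) / n = p at hp1 hpe ⊢
  replace hpe := hpe p rfl
  have hp0 : 0 < p := by linarith
  have hip : 0 ≤ 1 - 1 / p := sub_nonneg.2 ((div_le_one hp0).2 hp1)
  obtain ⟨T, hT⟩ : ∃ T : C → ℝ, ∀ c, T c =
    ∑ y ∈ Fintype.piFinset (fun _ : Fin n => B.erase c), h y ^ e := ⟨_, fun _ => rfl⟩
  simp only [← hT]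
  have hT0 : ∀ c, 0 ≤ T c := fun c => by
    rw [hT]; exact Finset.sum_nonneg fun y _ => pow_nonneg (hh y) _
  have hTp : ∀ c, 0 ≤ T c ^ p := fun c => Real.rpow_nonneg (hT0 c) _
  have hτ0 : ∀ c, 0 ≤ (T c ^ p) ^ (1 - 1 / p) := fun c => Real.rpow_nonneg (hTp c) _
  have hτT : ∀ c, T c ^ p = (T c ^ p) ^ (1 - 1 / p) * T c := by
    intro c
    have : (T c ^ p) ^ (1 / p) = T c := by
      rw [← Real.rpow_mul (hT0 c), mul_one_div_cancel hp0.ne', Real.rpow_one]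
    nth_rw 3 [← this]
    rw [← Real.rpow_add_of_nonneg (hTp c) hip (by positivity), sub_add_cancel, Real.rpow_one]
  have hg0 : ∀ y : Fin n → C, 0 ≤ ∑ c ∈ avoiding K y, (T c ^ p) ^ (1 - 1 / p) :=
    fun y => Finset.sum_nonneg fun c _ => hτ0 c
  have hSg : ∑ c ∈ K, T c ^ p = ∑ y ∈ Fintype.piFinset (fun _ : Fin n => B),
      h y ^ e * ∑ c ∈ avoiding K y, (T c ^ p) ^ (1 - 1 / p) := by
    rw [← sum_mul_sum_piFinset_erase]
    simp only [← hT]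
    exact Finset.sum_congr rfl fun c _ => hτT c
  have hd0 : (0 : ℝ) < (e : ℝ) + 1 := by positivity
  refine rpow_le_of_le_mul_rpow (G := ∑ y ∈ Fintype.piFinset (fun _ : Fin n => B),
    (∑ c ∈ avoiding K y, (T c ^ p) ^ (1 - 1 / p)) ^ (e + 1)) (Nat.cast_nonneg _) hp1
    (Finset.sum_nonneg fun c _ => hTp c) (Finset.sum_nonneg fun y _ => pow_nonneg (hh y) _)
    (Finset.sum_nonneg fun y _ => pow_nonneg (hg0 y) _) (Nat.cast_nonneg _) ?_ ?_
  · have := Finset.sum_rpow_mul_rpow_le (Fintype.piFinset (fun _ : Fin n => B))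
      (fun y => h y ^ (e + 1))
      (fun y => (∑ c ∈ avoiding K y, (T c ^ p) ^ (1 - 1 / p)) ^ (e + 1)) ((e : ℝ) / (e + 1))
      (fun y _ => pow_nonneg (hh y) _) (fun y _ => pow_nonneg (hg0 y) _) (by positivity)
      (by rw [div_le_one hd0]; linarith)
    rw [show 1 - (e : ℝ) / (e + 1) = 1 / ((e : ℝ) + 1) by
      rw [eq_div_iff hd0.ne', sub_mul, div_mul_cancel₀ _ hd0.ne']; ring] at this
    refine le_trans (le_of_eq ?_) this
    rw [hSg]
    refine Finset.sum_congr rfl fun y _ => ?_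
    generalize hw : ∑ c ∈ avoiding K y, (T c ^ p) ^ (1 - 1 / p) = w
    have hw0 : 0 ≤ w := hw ▸ hg0 y
    rw [← Real.rpow_natCast (h y) e, ← Real.rpow_natCast (h y) (e + 1),
      ← Real.rpow_natCast w (e + 1), ← Real.rpow_mul (hh y), ← Real.rpow_mul hw0]
    push_cast
    rw [mul_div_cancel₀ _ hd0.ne', mul_one_div_cancel hd0.ne', Real.rpow_one]
  · have := Finset.sum_rpow_mul_rpow_le (Fintype.piFinset (fun _ : Fin (e + 1) => K))
      (fun k => ∏ j, T (k j) ^ p) (fun k => ((avoiding B k).card : ℝ) ^ Δ) (1 - 1 / p)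
      (fun k _ => Finset.prod_nonneg fun j _ => hTp _) (fun k _ => pow_nonneg (Nat.cast_nonneg _) _) hip
      (by linarith [one_div_nonneg.2 hp0.le])
    rw [sub_sub_cancel, ← Finset.prod_univ_sum (fun _ => K) (fun _ c => T c ^ p),
      Finset.prod_const, Finset.card_univ, Fintype.card_fin] at this
    refine le_trans (le_of_eq ?_) (this.trans (le_of_eq ?_))
    · rw [sum_sum_avoiding_pow]
      refine Finset.sum_congr rfl fun k _ => ?_
      rw [← Real.finsetProd_rpow _ _ (fun j _ => hTp _), ← Real.rpow_natCast _ Δ,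
        ← Real.rpow_mul (Nat.cast_nonneg _), ← hpe, ← Real.rpow_natCast]
      congr 2
      field_simp
    · rw [bicliqueCount_eq_sum_left, Nat.cast_sum]
      simp only [Nat.cast_pow]
      rw [← Real.rpow_natCast _ (e + 1), Nat.cast_add, Nat.cast_one]

theorem sum_bicliqueNorm_div_pow_le (A B K : Finset C) {e n Δ : ℕ} (he : 1 ≤ e) (hn : 1 ≤ n)
    (hnΔ : n ≤ Δ) (hpos : 0 < bicliqueCount (e + 1) n A B) :
    ∑ c ∈ K, (bicliqueNorm e n A (B.erase c) / bicliqueNorm (e + 1) n A B) ^ (e * Δ) ≤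
      (bicliqueCount (e + 1) Δ K B : ℝ) ^ (1 / ((e : ℝ) + 1)) := by
  have hn0 : (0 : ℝ) < n := by exact_mod_cast hn
  have he0 : (0 : ℝ) < e := by exact_mod_cast he
  have key := sum_sum_erase_pow_rpow_le B K (e := e) hn hnΔ
    (fun y => ((avoiding A y).card : ℝ)) (fun y => Nat.cast_nonneg _)
  have e2 : ∀ (k : ℕ) (D : Finset C), ∑ y ∈ Fintype.piFinset (fun _ : Fin n => D),
      ((avoiding A y).card : ℝ) ^ k = bicliqueCount k n A D := by
    intro k D
    rw [bicliqueCount_eq_sum_right, Nat.cast_sum]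
    exact Finset.sum_congr rfl fun y hy => by rw [Nat.cast_pow]
  simp only [e2] at key
  have hposR : (0 : ℝ) < bicliqueCount (e + 1) n A B := Nat.cast_pos.2 hpos
  have hterm : ∀ c ∈ K,
      (bicliqueNorm e n A (B.erase c) / bicliqueNorm (e + 1) n A B) ^ (e * Δ) =
        (bicliqueCount e n A (B.erase c) : ℝ) ^ ((Δ : ℝ) / n) /
          (bicliqueCount (e + 1) n A B : ℝ) ^ ((e : ℝ) / (e + 1) * (Δ / n)) := by
    intro c _
    rw [div_pow, bicliqueNorm, bicliqueNorm, ← Real.rpow_natCast, ← Real.rpow_natCast,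
      ← Real.rpow_mul (Nat.cast_nonneg _), ← Real.rpow_mul (Nat.cast_nonneg _)]
    congr 2
    · push_cast
      field_simp
    · push_cast
      field_simp
  rw [Finset.sum_congr rfl hterm, ← Finset.sum_div, div_le_iff₀ (Real.rpow_pos_of_pos hposR _),
    mul_comm]
  exact key

end Biclique

/-! ### Admissible factors, one for each endpoint of an edge -/

theorem Finset.sum_prod_le_prod_rpow {ι α : Type*} (s : Finset α) (t : Finset ι) {n : ℕ}
    (hn : 1 ≤ n) (ht : t.card = n) (g : ι → α → ℝ) (R : ι → ℝ)
    (hg : ∀ i ∈ t, ∀ a ∈ s, 0 ≤ g i a) (hR : ∀ i ∈ t, ∑ a ∈ s, g i a ^ n ≤ R i) :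
    ∑ a ∈ s, ∏ i ∈ t, g i a ≤ ∏ i ∈ t, R i ^ (1 / (n : ℝ)) := by
  have hn0 : (0 : ℝ) < n := by exact_mod_cast hn
  have h := Finset.sum_prod_rpow_le_prod_sum_rpow s t (fun i a => g i a ^ n)
    (fun _ => 1 / (n : ℝ)) (fun i hi a ha => pow_nonneg (hg i hi a ha) _)
    (fun _ _ => by positivity) (by simp [ht, hn0.ne'])
  refine le_trans (le_of_eq ?_) (h.trans ?_)
  · refine Finset.sum_congr rfl fun a ha => Finset.prod_congr rfl fun i hi => ?_
    rw [← Real.rpow_natCast, ← Real.rpow_mul (hg i hi a ha), mul_one_div_cancel hn0.ne',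
      Real.rpow_one]
  · refine Finset.prod_le_prod (fun i hi => Real.rpow_nonneg (Finset.sum_nonneg fun a ha =>
      pow_nonneg (hg i hi a ha) _) _) fun i hi => ?_
    exact Real.rpow_le_rpow (Finset.sum_nonneg fun a ha => pow_nonneg (hg i hi a ha) _) (hR i hi)
      (by positivity)

section Factors

variable {C : Type*} [DecidableEq C]

/-- The moment bound which a factor attached to a neighbour (of degree `d`, with list `B`) of a
vertex of degree `Δ` with list `K` has to satisfy. -/
def IsAdmissible (Δ : ℕ) (K : Finset C) (d : ℕ) (B : Finset C) (γ : C → ℝ) : Prop :=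
  ∑ c ∈ K, γ c ^ ((d - 1) * Δ) ≤ (bicliqueCount d Δ K B : ℝ) ^ (1 / (d : ℝ))

/-- Cauchy–Schwarz. It serves to average the factors that the two orientations of an edge assign to
the same endpoint. -/
theorem IsAdmissible.sqrt_mul {Δ d : ℕ} {K B : Finset C} {γ₁ γ₂ : C → ℝ}
    (h₁ : IsAdmissible Δ K d B γ₁) (h₂ : IsAdmissible Δ K d B γ₂) (hn₁ : ∀ c, 0 ≤ γ₁ c)
    (hn₂ : ∀ c, 0 ≤ γ₂ c) : IsAdmissible Δ K d B fun c => √(γ₁ c * γ₂ c) := by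
  unfold IsAdmissible at *
  generalize (d - 1) * Δ = m at *
  set R := (bicliqueCount d Δ K B : ℝ) ^ (1 / (d : ℝ)) with hR
  have hR0 : 0 ≤ R := Real.rpow_nonneg (Nat.cast_nonneg _) _
  have := Finset.sum_rpow_mul_rpow_le K (fun c => γ₁ c ^ m) (fun c => γ₂ c ^ m) (1 / 2)
    (fun c _ => pow_nonneg (hn₁ c) _) (fun c _ => pow_nonneg (hn₂ c) _) (by norm_num)
    (by norm_num)
  rw [show (1 : ℝ) - 1 / 2 = 1 / 2 by norm_num] at this
  simp only [← Real.sqrt_eq_rpow] at this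
  have hpow : ∀ x : ℝ, 0 ≤ x → √(x ^ m) = √x ^ m := fun x hx => by
    rw [Real.sqrt_eq_iff_eq_sq (pow_nonneg hx _) (by positivity), ← pow_mul, mul_comm m 2,
      pow_mul, Real.sq_sqrt hx]
  calc ∑ c ∈ K, √(γ₁ c * γ₂ c) ^ m = ∑ c ∈ K, √(γ₁ c ^ m) * √(γ₂ c ^ m) :=
        Finset.sum_congr rfl fun c _ => by
          rw [Real.sqrt_mul (hn₁ c), mul_pow, hpow _ (hn₁ c), hpow _ (hn₂ c)]
    _ ≤ √R * √R := this.trans (by gcongr)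
    _ = R := Real.mul_self_sqrt hR0

theorem isAdmissible_bicliqueNorm_div {A B : Finset C} (K : Finset C) {d n Δ : ℕ} (hd : 2 ≤ d)
    (hn : 1 ≤ n) (hnΔ : n ≤ Δ) (hpos : 0 < bicliqueCount d n A B) :
    IsAdmissible Δ K d B fun c => bicliqueNorm (d - 1) n A (B.erase c) / bicliqueNorm d n A B := by
  obtain ⟨e, rfl⟩ : ∃ e, d = e + 1 := ⟨d - 1, by omega⟩
  simpa [IsAdmissible] using
    sum_bicliqueNorm_div_pow_le A B K (show 1 ≤ e by omega) hn hnΔ hpos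

/-- Removing a color from the lists of some endpoints of an edge, and simultaneously decreasing
their degrees, changes the norm by at most a product of admissible factors. -/
theorem exists_isAdmissible_factors {A B : Finset C} (K : Finset C) {a b Δ : ℕ} (p q : Prop)
    [Decidable p] [Decidable q] (ha : 1 ≤ a) (hb : 1 ≤ b) (haΔ : a ≤ Δ) (hbΔ : b ≤ Δ)
    (hp : p → 2 ≤ a) (hq : q → 2 ≤ b) {x y : C} (hx : x ∈ A) (hy : y ∈ B) (hxy : x ≠ y) :
    ∃ γ₁ γ₂ : C → ℝ, (∀ c, 0 ≤ γ₁ c) ∧ (∀ c, 0 ≤ γ₂ c) ∧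
      (¬ p → ∀ c, γ₁ c = 1) ∧ (¬ q → ∀ c, γ₂ c = 1) ∧
      (p → IsAdmissible Δ K a A γ₁) ∧ (q → IsAdmissible Δ K b B γ₂) ∧
      ∀ c, bicliqueNorm (if q then b - 1 else b) (if p then a - 1 else a)
        (if p then A.erase c else A) (if q then B.erase c else B) ≤
          bicliqueNorm b a A B * (γ₁ c * γ₂ c) := by
  have hAB := bicliqueCount_pos hx hy hxy
  have hBA := bicliqueCount_pos hy hx hxy.symm
  have hnorm : ∀ s t, 0 < bicliqueNorm s t A B := fun s t =>
    Real.rpow_pos_of_pos (Nat.cast_pos.2 (hAB s t)) _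
  have hdiv : ∀ s t s' t' (A B A' B' : Finset C),
      0 ≤ bicliqueNorm s t A B / bicliqueNorm s' t' A' B' := fun _ _ _ _ _ _ _ _ =>
    div_nonneg (bicliqueNorm_nonneg ..) (bicliqueNorm_nonneg ..)
  by_cases h1 : p <;> by_cases h2 : q
  -- The two endpoints are treated in succession, so the second quotient already has `a - 1` in
  -- place of `a`. The moment bound allows this since it holds for every `n` with `1 ≤ n ≤ Δ`.
  · refine ⟨fun c => bicliqueNorm (a - 1) b B (A.erase c) / bicliqueNorm a b B A,
      fun c => bicliqueNorm (b - 1) (a - 1) A (B.erase c) / bicliqueNorm b (a - 1) A B,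
      fun c => hdiv .., fun c => hdiv .., fun h => absurd h1 h, fun h => absurd h2 h,
      fun _ => isAdmissible_bicliqueNorm_div K (hp h1) hb hbΔ (hBA _ _),
      fun _ => isAdmissible_bicliqueNorm_div K (hq h2) (by have := hp h1; omega) (by omega)
        (hAB _ _), fun c => ?_⟩
    have := bicliqueNorm_erase_erase_mul_le (s := b - 1) (t := a - 1) (by have := hq h2; omega)
      (by have := hp h1; omega) A B c
    rw [Nat.sub_add_cancel hb] at this
    beta_reduce
    rw [if_pos h2, if_pos h1, if_pos h1, if_pos h2, bicliqueNorm_comm a b B A,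
      bicliqueNorm_comm (a - 1) b B, ← mul_assoc, mul_div_cancel₀ _ (hnorm _ _).ne', ← mul_div_assoc,
      le_div_iff₀ (hnorm _ _), mul_comm (bicliqueNorm b (a - 1) (A.erase c) B)]
    exact this
  · refine ⟨fun c => bicliqueNorm (a - 1) b B (A.erase c) / bicliqueNorm a b B A, fun _ => 1,
      fun c => hdiv .., fun _ => zero_le_one, fun h => absurd h1 h, fun _ _ => rfl,
      fun _ => isAdmissible_bicliqueNorm_div K (hp h1) hb hbΔ (hBA _ _),
      fun h => absurd h h2, fun c => ?_⟩
    beta_reduce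
    rw [if_neg h2, if_pos h1, if_pos h1, if_neg h2, bicliqueNorm_comm a b B A,
      bicliqueNorm_comm (a - 1) b B, mul_one, mul_div_cancel₀ _ (hnorm _ _).ne']
  · refine ⟨fun _ => 1, fun c => bicliqueNorm (b - 1) a A (B.erase c) / bicliqueNorm b a A B,
      fun _ => zero_le_one, fun c => hdiv .., fun _ _ => rfl, fun h => absurd h2 h,
      fun h => absurd h h1,
      fun _ => isAdmissible_bicliqueNorm_div K (hq h2) ha haΔ (hAB _ _), fun c => ?_⟩
    rw [if_pos h2, if_neg h1, if_neg h1, if_pos h2, one_mul, mul_div_cancel₀ _ (hnorm _ _).ne']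
  · refine ⟨fun _ => 1, fun _ => 1, fun _ => zero_le_one, fun _ => zero_le_one, fun _ _ => rfl,
      fun _ _ => rfl, fun h => absurd h h1, fun h => absurd h h2, fun c => ?_⟩
    rw [if_neg h2, if_neg h1, if_neg h1, if_neg h2, one_mul, mul_one]

end Factors

/-! ### List colorings and the edge-product bound -/

section ListColorings

variable {V C : Type*} [Fintype V]

open Classical in
noncomputable def nbrs (G : SimpleGraph V) (v : V) : Finset V :=
  Finset.univ.filter (G.Adj v)

@[simp] theorem mem_nbrs {G : SimpleGraph V} {v u : V} : u ∈ nbrs G v ↔ G.Adj v u := by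
  simp [nbrs]

/-- Remove all edges at `w`. -/
def isolate (G : SimpleGraph V) (w : V) : SimpleGraph V where
  Adj u v := G.Adj u v ∧ u ≠ w ∧ v ≠ w
  symm := ⟨fun _ _ h => ⟨h.1.symm, h.2.2, h.2.1⟩⟩
  loopless := ⟨fun _ h => h.1.ne rfl⟩

theorem nbrs_isolate_self (G : SimpleGraph V) (w : V) : nbrs (isolate G w) w = ∅ := by
  ext u
  simp [isolate]

open Classical in
noncomputable def isolatedFactor (G : SimpleGraph V) (L : V → Finset C) (v : V) : ℝ :=
  if nbrs G v = ∅ then ((L v).card : ℝ) else 1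

theorem isolatedFactor_nonneg (G : SimpleGraph V) (L : V → Finset C) (v : V) :
    0 ≤ isolatedFactor G L v := by
  unfold isolatedFactor
  split_ifs <;> positivity

variable [DecidableEq C]

/-- The sizes are crossed: the side with list `L v` has `deg u` vertices, so that each of them has
degree `deg v`, as `v` does. -/
noncomputable def edgeNorm (G : SimpleGraph V) (L : V → Finset C) (v u : V) : ℝ :=
  bicliqueNorm (nbrs G u).card (nbrs G v).card (L v) (L u)

/-- Each edge occurs in both orientations, hence the square roots. -/
noncomputable def colorBound (G : SimpleGraph V) (L : V → Finset C) : ℝ :=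
  (∏ v, isolatedFactor G L v) * ∏ v, ∏ u ∈ nbrs G v, √(edgeNorm G L v u)

theorem edgeNorm_nonneg (G : SimpleGraph V) (L : V → Finset C) (v u : V) :
    0 ≤ edgeNorm G L v u := bicliqueNorm_nonneg ..

theorem edgeNorm_comm (G : SimpleGraph V) (L : V → Finset C) (v u : V) :
    edgeNorm G L v u = edgeNorm G L u v := bicliqueNorm_comm ..

theorem colorBound_nonneg (G : SimpleGraph V) (L : V → Finset C) : 0 ≤ colorBound G L :=
  mul_nonneg (Finset.prod_nonneg fun v _ => isolatedFactor_nonneg G L v)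
    (Finset.prod_nonneg fun _ _ => Finset.prod_nonneg fun _ _ => Real.sqrt_nonneg _)

variable [DecidableEq V]

open Classical in
/-- The proper colorings of `G` in which every vertex `v` has a color from `L v`. -/
noncomputable def listColorings (G : SimpleGraph V) (L : V → Finset C) : Finset (V → C) :=
  (Fintype.piFinset L).filter fun f => ∀ u v, G.Adj u v → f u ≠ f v

theorem mem_listColorings {G : SimpleGraph V} {L : V → Finset C} {f : V → C} :
    f ∈ listColorings G L ↔ (∀ v, f v ∈ L v) ∧ ∀ u v, G.Adj u v → f u ≠ f v := by
  simp [listColorings]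

theorem nbrs_isolate_of_ne (G : SimpleGraph V) {w v : V} (h : v ≠ w) :
    nbrs (isolate G w) v = (nbrs G v).erase w := by
  ext u
  simp [isolate, h, and_comm]

open Classical in
/-- The lists that remain after `w` has received the color `c`. -/
noncomputable def condLists (G : SimpleGraph V) (L : V → Finset C) (w : V) (c : C) (v : V) :
    Finset C :=
  if v = w then {c} else if G.Adj w v then (L v).erase c else L v

theorem card_listColorings_eq_sum (G : SimpleGraph V) (L : V → Finset C) (w : V) :
    (listColorings G L).card =
      ∑ c ∈ L w, (listColorings (isolate G w) (condLists G L w c)).card := by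
  rw [Finset.card_eq_sum_card_fiberwise (f := fun f => f w) (t := L w)
    fun f hf => (mem_listColorings.1 hf).1 w]
  refine Finset.sum_congr rfl fun c hc => congrArg Finset.card ?_
  ext f
  simp only [Finset.mem_filter, mem_listColorings, condLists, isolate]
  constructor
  · rintro ⟨⟨h1, h2⟩, rfl⟩
    refine ⟨fun v => ?_, fun u v h => h2 u v h.1⟩
    split_ifs with hv hadj
    · simp [hv]
    · exact Finset.mem_erase.2 ⟨(h2 w v hadj).symm, h1 v⟩
    · exact h1 v
  · rintro ⟨h1, h2⟩
    have hw : f w = c := by simpa using h1 w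
    have hN : ∀ v, G.Adj w v → f v ≠ c := by
      intro v hv
      have := h1 v
      rw [if_neg hv.ne', if_pos hv] at this
      exact (Finset.mem_erase.1 this).1
    refine ⟨⟨fun v => ?_, fun u v h => ?_⟩, hw⟩
    · have := h1 v
      split_ifs at this with hv hadj
      · rw [hv, hw]; exact hc
      · exact Finset.mem_of_mem_erase this
      · exact this
    · by_cases hu : u = w
      · subst hu
        rw [hw]
        exact (hN v h).symm
      · by_cases hv : v = w
        · subst hv
          rw [hw]
          exact hN u h.symm
        · exact h2 u v ⟨h, hu, hv⟩

theorem colorBound_eq_of_vertex (G : SimpleGraph V) (L : V → Finset C) (w : V) :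
    colorBound G L = (∏ v, isolatedFactor G L v) *
      (∏ v, ∏ u ∈ nbrs (isolate G w) v, √(edgeNorm G L v u)) *
        ∏ v ∈ nbrs G w, edgeNorm G L w v := by
  rw [colorBound, mul_assoc]
  congr 1
  rw [← Finset.mul_prod_erase _ _ (Finset.mem_univ w), ← Finset.mul_prod_erase Finset.univ
    (fun v => ∏ u ∈ nbrs (isolate G w) v, √(edgeNorm G L v u)) (Finset.mem_univ w),
    nbrs_isolate_self, Finset.prod_empty, one_mul]
  have h : ∀ v ∈ Finset.univ.erase w, ∏ u ∈ nbrs G v, √(edgeNorm G L v u) =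
      (∏ u ∈ nbrs (isolate G w) v, √(edgeNorm G L v u)) *
        if v ∈ nbrs G w then √(edgeNorm G L w v) else 1 := by
    intro v hv
    rw [nbrs_isolate_of_ne G (Finset.ne_of_mem_erase hv)]
    split_ifs with hvw
    · rw [edgeNorm_comm G L w v,
        Finset.prod_erase_mul _ _ (mem_nbrs.2 (mem_nbrs.1 hvw).symm)]
    · rw [Finset.erase_eq_of_notMem (by simpa [G.adj_comm] using hvw), mul_one]
  have hN : (Finset.univ.erase w).filter (· ∈ nbrs G w) = nbrs G w := by
    ext v
    simp only [Finset.mem_filter, Finset.mem_erase, Finset.mem_univ, and_true, mem_nbrs]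
    exact ⟨fun h => h.2, fun h => ⟨h.ne', h⟩⟩
  rw [Finset.prod_congr rfl h, Finset.prod_mul_distrib, ← Finset.prod_filter, hN, mul_left_comm,
    ← Finset.prod_mul_distrib]
  congr 1
  exact Finset.prod_congr rfl fun v _ => Real.mul_self_sqrt (edgeNorm_nonneg ..)

end ListColorings

/-! ### Fixing the color of a vertex of maximum degree -/

section ListColorings

variable {V C : Type*} [Fintype V] [DecidableEq V] [DecidableEq C]

theorem isolatedFactor_isolate (G : SimpleGraph V) (L : V → Finset C) {w : V}
    (hw : (nbrs G w).Nonempty) (c : C) (v : V) :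
    isolatedFactor (isolate G w) (condLists G L w c) v = isolatedFactor G L v *
      if nbrs G v = {w} then (((L v).erase c).card : ℝ) else 1 := by
  unfold isolatedFactor condLists
  by_cases hv : v = w
  · subst hv
    have h1 : nbrs G v ≠ {v} := fun h => by
      have : v ∈ nbrs G v := h ▸ Finset.mem_singleton_self v
      exact (mem_nbrs.1 this).ne rfl
    rw [nbrs_isolate_self, if_neg hw.ne_empty, if_neg h1]
    simp
  · rw [nbrs_isolate_of_ne G hv, if_neg hv]
    by_cases hadj : G.Adj w v
    · have hmem : w ∈ nbrs G v := mem_nbrs.2 hadj.symm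
      rw [if_pos hadj, if_neg (Finset.ne_empty_of_mem hmem), one_mul]
      by_cases h : nbrs G v = {w}
      · rw [if_pos h, if_pos (by rw [h, Finset.erase_singleton])]
      · rw [if_neg h, if_neg fun h' => h (by rw [← Finset.insert_erase hmem, h']; rfl)]
    · have hmem : w ∉ nbrs G v := fun h => hadj (mem_nbrs.1 h).symm
      have h1 : nbrs G v ≠ {w} := fun h => hmem (h ▸ Finset.mem_singleton_self w)
      rw [if_neg hadj, Finset.erase_eq_of_notMem hmem, if_neg h1, mul_one]

theorem exists_edge_factors (G : SimpleGraph V) (L : V → Finset C) (K : Finset C) (w : V)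
    (hmax : ∀ v, (nbrs G v).card ≤ (nbrs G w).card) {f : V → C} (hf : f ∈ listColorings G L)
    {v u : V} (hvu : u ∈ nbrs (isolate G w) v) :
    ∃ γ₁ γ₂ : C → ℝ, (∀ c, 0 ≤ γ₁ c) ∧ (∀ c, 0 ≤ γ₂ c) ∧
      (¬ G.Adj w v → ∀ c, γ₁ c = 1) ∧ (¬ G.Adj w u → ∀ c, γ₂ c = 1) ∧
      (G.Adj w v → IsAdmissible (nbrs G w).card K (nbrs G v).card (L v) γ₁) ∧
      (G.Adj w u → IsAdmissible (nbrs G w).card K (nbrs G u).card (L u) γ₂) ∧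
      ∀ c, edgeNorm (isolate G w) (condLists G L w c) v u ≤
        edgeNorm G L v u * (γ₁ c * γ₂ c) := by
  classical
  obtain ⟨hadj, hv, hu⟩ := mem_nbrs.1 hvu
  rw [mem_listColorings] at hf
  have hcard : ∀ x, x ≠ w → (nbrs (isolate G w) x).card =
      if G.Adj w x then (nbrs G x).card - 1 else (nbrs G x).card := by
    intro x hx
    rw [nbrs_isolate_of_ne G hx]
    split_ifs with h
    · rw [Finset.card_erase_of_mem (mem_nbrs.2 h.symm)]
    · rw [Finset.erase_eq_of_notMem fun h' => h (mem_nbrs.1 h').symm]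
  -- Both `y` and `w` are neighbors of `x`, so its degree stays positive after removing `w`.
  have htwo : ∀ x y, G.Adj x y → y ≠ w → G.Adj w x → 2 ≤ (nbrs G x).card := by
    intro x y hxy hy hwx
    exact Finset.one_lt_card.2 ⟨y, mem_nbrs.2 hxy, w, mem_nbrs.2 hwx.symm, hy⟩
  obtain ⟨γ₁, γ₂, h1, h2, h3, h4, h5, h6, h7⟩ := exists_isAdmissible_factors K
    (G.Adj w v) (G.Adj w u) (Finset.card_pos.2 ⟨u, mem_nbrs.2 hadj⟩)
    (Finset.card_pos.2 ⟨v, mem_nbrs.2 hadj.symm⟩) (hmax v) (hmax u) (htwo v u hadj hu)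
    (htwo u v hadj.symm hv) (hf.1 v) (hf.1 u) (hf.2 v u hadj)
  refine ⟨γ₁, γ₂, h1, h2, h3, h4, h5, h6, fun c => ?_⟩
  have := h7 c
  unfold edgeNorm condLists
  rw [hcard v hv, hcard u hu, if_neg hv, if_neg hu]
  convert this

/-- After fixing the color of a vertex `w` of maximum degree, the bound for the remaining graph
is at most the bound for the edges not at `w`, times one factor for each neighbour of `w`. -/
theorem exists_vertex_factors (G : SimpleGraph V) (L : V → Finset C) {w : V}
    (hw : (nbrs G w).Nonempty) (hmax : ∀ v, (nbrs G v).card ≤ (nbrs G w).card)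
    {f : V → C} (hf : f ∈ listColorings G L) :
    ∃ g : V → C → ℝ, (∀ v c, 0 ≤ g v c) ∧
      (∀ v ∈ nbrs G w, ∑ c ∈ L w, g v c ^ (nbrs G w).card ≤
        (bicliqueCount (nbrs G v).card (nbrs G w).card (L w) (L v) : ℝ) ^
          (1 / ((nbrs G v).card : ℝ))) ∧
      ∀ c, colorBound (isolate G w) (condLists G L w c) ≤
        (∏ v, isolatedFactor G L v) *
          (∏ v, ∏ u ∈ nbrs (isolate G w) v, √(edgeNorm G L v u)) * ∏ v ∈ nbrs G w, g v c := by
  have hex : ∀ v u, ∃ γ₁ γ₂ : C → ℝ, u ∈ nbrs (isolate G w) v →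
      (∀ c, 0 ≤ γ₁ c) ∧ (∀ c, 0 ≤ γ₂ c) ∧
      (¬ G.Adj w v → ∀ c, γ₁ c = 1) ∧ (¬ G.Adj w u → ∀ c, γ₂ c = 1) ∧
      (G.Adj w v → IsAdmissible (nbrs G w).card (L w) (nbrs G v).card (L v) γ₁) ∧
      (G.Adj w u → IsAdmissible (nbrs G w).card (L w) (nbrs G u).card (L u) γ₂) ∧
      ∀ c, edgeNorm (isolate G w) (condLists G L w c) v u ≤
        edgeNorm G L v u * (γ₁ c * γ₂ c) := by
    intro v u
    by_cases h : u ∈ nbrs (isolate G w) v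
    · obtain ⟨γ₁, γ₂, hγ⟩ := exists_edge_factors G L (L w) w hmax hf h
      exact ⟨γ₁, γ₂, fun _ => hγ⟩
    · exact ⟨1, 1, fun h' => absurd h' h⟩
  choose γ₁ γ₂ hγ using hex
  have hsymm : ∀ {v u}, u ∈ nbrs (isolate G w) v → v ∈ nbrs (isolate G w) u := fun h =>
    mem_nbrs.2 (mem_nbrs.1 h).symm
  -- The factor of `v` collects what both orientations of each edge `vu` assign to `v`: `γ₁ v u` and
  -- `γ₂ u v`. A neighbor with no edge other than the one to `w` becomes isolated and contributes
  -- its shortened list instead.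
  refine ⟨fun v c => (if nbrs G v = {w} then (((L v).erase c).card : ℝ) else 1) *
    ∏ u ∈ nbrs (isolate G w) v, √(γ₁ v u c * γ₂ u v c), fun v c => ?_, fun v hv => ?_,
    fun c => ?_⟩
  · exact mul_nonneg (by split_ifs <;> positivity)
      (Finset.prod_nonneg fun _ _ => Real.sqrt_nonneg _)
  · have hadj := mem_nbrs.1 hv
    have hvw : v ≠ w := hadj.ne'
    have hmem : w ∈ nbrs G v := mem_nbrs.2 hadj.symm
    -- For a leaf the moment is exactly the number of colorings of the star K_{1,Δ}, summed over the
    -- color of its center.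
    by_cases h1 : nbrs G v = {w}
    · refine le_of_eq ?_
      beta_reduce
      rw [nbrs_isolate_of_ne G hvw, h1, Finset.erase_singleton]
      simp only [if_true, Finset.prod_empty, mul_one, Finset.card_singleton, Nat.cast_one,
        div_one, Real.rpow_one]
      rw [bicliqueCount_eq_sum_left, Nat.cast_sum]
      refine Finset.sum_bij' (fun c _ => fun _ => c) (fun x _ => x 0) ?_ ?_ ?_ ?_ ?_
      · simp
      · intro x hx
        exact Fintype.mem_piFinset.1 hx 0
      · simp
      · intro x _
        funext i
        rw [Subsingleton.elim i 0]
      · intro c _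
        rw [Nat.cast_pow]
        congr 3
        ext y
        simp [avoiding, and_comm]
    · simp only [if_neg h1, one_mul]
      have hne : 1 ≤ (nbrs (isolate G w) v).card := by
        rw [nbrs_isolate_of_ne G hvw, Finset.one_le_card, Finset.nonempty_iff_ne_empty]
        intro h
        exact h1 (by rw [← Finset.insert_erase hmem, h]; rfl)
      have hcard : (nbrs (isolate G w) v).card = (nbrs G v).card - 1 := by
        rw [nbrs_isolate_of_ne G hvw, Finset.card_erase_of_mem hmem]
      simp only [← Finset.prod_pow]
      set R := (bicliqueCount (nbrs G v).card (nbrs G w).card (L w) (L v) : ℝ) ^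
          (1 / ((nbrs G v).card : ℝ)) with hR
      have hR0 : 0 ≤ R := Real.rpow_nonneg (Nat.cast_nonneg _) _
      -- Hölder over the `deg v - 1` remaining neighbors of `v`; this is the origin of the exponent
      -- `(d - 1) * Δ` in `IsAdmissible`.
      refine (Finset.sum_prod_le_prod_rpow (L w) (nbrs (isolate G w) v) hne rfl
        (fun u c => √(γ₁ v u c * γ₂ u v c) ^ (nbrs G w).card) (fun _ => R)
        (fun _ _ _ _ => pow_nonneg (Real.sqrt_nonneg _) _) fun u hu => ?_).trans (le_of_eq ?_)
      · have h2 := hγ v u hu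
        have h3 := hγ u v (hsymm hu)
        have h4 := (h2.2.2.2.2.1 hadj).sqrt_mul (h3.2.2.2.2.2.1 hadj) h2.1 h3.2.1
        refine le_trans (le_of_eq ?_) h4
        refine Finset.sum_congr rfl fun c _ => ?_
        rw [← pow_mul, hcard, mul_comm (nbrs G w).card]
      · rw [Finset.prod_const, ← Real.rpow_natCast, ← Real.rpow_mul hR0, one_div_mul_cancel,
          Real.rpow_one]
        exact_mod_cast (by omega : (nbrs (isolate G w) v).card ≠ 0)
  · have hrestrict : ∏ v ∈ nbrs G w, ((if nbrs G v = {w} then (((L v).erase c).card : ℝ) else 1) *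
        ∏ u ∈ nbrs (isolate G w) v, √(γ₁ v u c * γ₂ u v c)) =
        ∏ v, ((if nbrs G v = {w} then (((L v).erase c).card : ℝ) else 1) *
          ∏ u ∈ nbrs (isolate G w) v, √(γ₁ v u c * γ₂ u v c)) := by
      refine Finset.prod_subset (Finset.subset_univ _) fun v _ hv => ?_
      have hadj : ¬ G.Adj w v := fun h => hv (mem_nbrs.2 h)
      rw [if_neg, one_mul]
      · refine Finset.prod_eq_one fun u hu => ?_
        rw [(hγ v u hu).2.2.1 hadj, (hγ u v (hsymm hu)).2.2.2.1 hadj, one_mul, Real.sqrt_one]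
      · intro h
        have : w ∈ nbrs G v := h ▸ Finset.mem_singleton_self w
        exact hadj (mem_nbrs.1 this).symm
    have hswap : ∏ v, ∏ u ∈ nbrs (isolate G w) v, √(γ₂ v u c) =
        ∏ v, ∏ u ∈ nbrs (isolate G w) v, √(γ₂ u v c) :=
      Finset.prod_comm' fun v u => by
        simp only [Finset.mem_univ, true_and, and_true]
        exact ⟨hsymm, hsymm⟩
    have hedges : ∏ v, ∏ u ∈ nbrs (isolate G w) v,
        √(edgeNorm (isolate G w) (condLists G L w c) v u) ≤
        (∏ v, ∏ u ∈ nbrs (isolate G w) v, √(edgeNorm G L v u)) *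
          ∏ v, ∏ u ∈ nbrs (isolate G w) v, √(γ₁ v u c * γ₂ u v c) := by
      calc _ ≤ ∏ v, ∏ u ∈ nbrs (isolate G w) v,
            (√(edgeNorm G L v u) * (√(γ₁ v u c) * √(γ₂ v u c))) := by
            refine Finset.prod_le_prod
              (fun _ _ => Finset.prod_nonneg fun _ _ => Real.sqrt_nonneg _) fun v _ =>
              Finset.prod_le_prod (fun _ _ => Real.sqrt_nonneg _) fun u hu => ?_
            rw [← Real.sqrt_mul ((hγ v u hu).1 c), ← Real.sqrt_mul (edgeNorm_nonneg ..)]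
            exact Real.sqrt_le_sqrt ((hγ v u hu).2.2.2.2.2.2 c)
        _ = _ := by
            simp only [Finset.prod_mul_distrib]
            rw [hswap]
            simp only [← Finset.prod_mul_distrib]
            refine Finset.prod_congr rfl fun v _ => Finset.prod_congr rfl fun u hu => ?_
            rw [Real.sqrt_mul ((hγ v u hu).1 c)]
    rw [hrestrict, Finset.prod_mul_distrib, colorBound]
    simp only [isolatedFactor_isolate G L hw, Finset.prod_mul_distrib]
    have hnn : 0 ≤ (∏ v, isolatedFactor G L v) *
        ∏ v, if nbrs G v = {w} then (((L v).erase c).card : ℝ) else 1 :=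
      mul_nonneg (Finset.prod_nonneg fun v _ => isolatedFactor_nonneg G L v)
        (Finset.prod_nonneg fun v _ => by split_ifs <;> positivity)
    refine (mul_le_mul_of_nonneg_left hedges hnn).trans (le_of_eq ?_)
    ring

/-- The number of proper list colorings of a graph is bounded by a product over its edges. -/
theorem card_listColorings_le_colorBound (G : SimpleGraph V) (L : V → Finset C) :
    ((listColorings G L).card : ℝ) ≤ colorBound G L := by
  induction hk : (Finset.univ.filter fun v => nbrs G v ≠ ∅).card using Nat.strong_induction_on
    generalizing G L with
  | _ k ih =>
  by_cases hE : ∀ v, nbrs G v = ∅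
  · have hb : colorBound G L = ∏ v, ((L v).card : ℝ) := by
      simp [colorBound, isolatedFactor, hE]
    rw [hb, ← Nat.cast_prod, ← Fintype.card_piFinset]
    exact_mod_cast Finset.card_le_card fun f hf =>
      Fintype.mem_piFinset.2 (mem_listColorings.1 hf).1
  -- A coloring `f` puts distinct colors in the lists at the ends of every edge, which makes all
  -- biclique counts used as denominators positive.
  rcases (listColorings G L).eq_empty_or_nonempty with h0 | ⟨f, hf⟩
  · rw [h0, Finset.card_empty, Nat.cast_zero]
    exact colorBound_nonneg G L
  push Not at hE
  obtain ⟨v₀, hv₀⟩ := hE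
  -- Maximality of the degree supplies the condition `n ≤ Δ` of the moment bound.
  obtain ⟨w, -, hmax⟩ := Finset.exists_max_image Finset.univ (fun v => (nbrs G v).card)
    ⟨v₀, Finset.mem_univ _⟩
  replace hmax := fun v => hmax v (Finset.mem_univ v)
  have hw : (nbrs G w).Nonempty := Finset.card_pos.1
    ((Finset.card_pos.2 hv₀).trans_le (hmax v₀))
  have hlt : (Finset.univ.filter fun v => nbrs (isolate G w) v ≠ ∅).card < k := by
    rw [← hk]
    refine Finset.card_lt_card (Finset.ssubset_iff_of_subset ?_ |>.2 ⟨w, ?_, ?_⟩)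
    · intro v hv
      simp only [Finset.mem_filter, Finset.mem_univ, true_and] at hv ⊢
      intro h
      have hvw : v ≠ w := fun h' => hv (h' ▸ nbrs_isolate_self G w)
      exact hv (by rw [nbrs_isolate_of_ne G hvw, h, Finset.erase_empty])
    · simpa using hw.ne_empty
    · simp [nbrs_isolate_self]
  obtain ⟨g, hg0, hg, hgle⟩ := exists_vertex_factors G L hw hmax hf
  set Q := (∏ v, isolatedFactor G L v) *
    ∏ v, ∏ u ∈ nbrs (isolate G w) v, √(edgeNorm G L v u) with hQ
  have hQ0 : 0 ≤ Q := mul_nonneg (Finset.prod_nonneg fun v _ => isolatedFactor_nonneg G L v)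
    (Finset.prod_nonneg fun _ _ => Finset.prod_nonneg fun _ _ => Real.sqrt_nonneg _)
  rw [card_listColorings_eq_sum G L w, Nat.cast_sum, colorBound_eq_of_vertex G L w, ← hQ]
  calc ∑ c ∈ L w, ((listColorings (isolate G w) (condLists G L w c)).card : ℝ)
      ≤ ∑ c ∈ L w, Q * ∏ v ∈ nbrs G w, g v c :=
        Finset.sum_le_sum fun c _ => (ih _ hlt _ _ rfl).trans (hgle c)
    _ = Q * ∑ c ∈ L w, ∏ v ∈ nbrs G w, g v c := by rw [Finset.mul_sum]
    _ ≤ Q * ∏ v ∈ nbrs G w, ((bicliqueCount (nbrs G v).card (nbrs G w).card (L w) (L v) : ℝ) ^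
          (1 / ((nbrs G v).card : ℝ))) ^ (1 / ((nbrs G w).card : ℝ)) :=
        mul_le_mul_of_nonneg_left (Finset.sum_prod_le_prod_rpow _ _ (Finset.card_pos.2 hw) rfl _ _
          (fun v _ c _ => hg0 v c) hg) hQ0
    _ = Q * ∏ v ∈ nbrs G w, edgeNorm G L w v := by
        congr 1
        refine Finset.prod_congr rfl fun v _ => ?_
        rw [edgeNorm, bicliqueNorm, ← Real.rpow_mul (Nat.cast_nonneg _), one_div_mul_one_div]

end ListColorings

/-! ### Specialization to regular graphs with all colors allowed -/

theorem natCard_coloring_completeBipartiteGraph (d q : ℕ) :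
    Nat.card ((completeBipartiteGraph (Fin d) (Fin d)).Coloring (Fin q)) =
      bicliqueCount d d (Finset.univ : Finset (Fin q)) Finset.univ := by
  rw [bicliqueCount, ← Nat.card_eq_finsetCard]
  exact Nat.card_congr
    { toFun := fun f => ⟨(fun i => f (Sum.inl i), fun j => f (Sum.inr j)),
        mem_bicliqueColorings.2 ⟨⟨fun _ => Finset.mem_univ _, fun _ => Finset.mem_univ _⟩,
          fun _ _ => f.valid (by simp)⟩⟩
      invFun := fun z => SimpleGraph.Coloring.mk (Sum.elim z.1.1 z.1.2) fun {u v} h => by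
        have hz := (mem_bicliqueColorings.1 z.2).2
        rcases u with u | u <;> rcases v with v | v
        · simp at h
        · exact hz u v
        · exact (hz v u).symm
        · simp at h
      left_inv := fun f => RelHom.ext fun v => by cases v <;> rfl
      right_inv := fun _ => rfl }

theorem natCard_coloring_eq_card_listColorings {V : Type*} [Fintype V] [DecidableEq V]
    (G : SimpleGraph V) (q : ℕ) :
    Nat.card (G.Coloring (Fin q)) =
      (listColorings G fun _ => (Finset.univ : Finset (Fin q))).card := by
  rw [← Nat.card_eq_finsetCard]
  exact Nat.card_congr
    { toFun := fun f => ⟨f, mem_listColorings.2 ⟨fun _ => Finset.mem_univ _, fun _ _ h =>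
        f.valid h⟩⟩
      invFun := fun f => SimpleGraph.Coloring.mk f.1 fun h => (mem_listColorings.1 f.2).2 _ _ h
      left_inv := fun _ => rfl
      right_inv := fun _ => rfl }

theorem mainTheorem5 {V : Type*} [Fintype V] [Nonempty V] (G : SimpleGraph V) [DecidableRel G.Adj]
    (d : ℕ) (hd : 1 ≤ d) (hG : G.IsRegularOfDegree d) (q : ℕ) (hq : 1 ≤ q) :
    (Nat.card (G.Coloring (Fin q)) : ℝ) ^ ((1 : ℝ) / (Fintype.card V : ℝ)) ≤
      (Nat.card ((completeBipartiteGraph (Fin d) (Fin d)).Coloring (Fin q)) : ℝ) ^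
        ((1 : ℝ) / (2 * (d : ℝ))) := by
  classical
  have hd0 : (0 : ℝ) < d := by exact_mod_cast hd
  have hV0 : (0 : ℝ) < Fintype.card V := by exact_mod_cast Fintype.card_pos
  have hcard : ∀ v, (nbrs G v).card = d := by
    intro v
    rw [← hG v, ← SimpleGraph.card_neighborFinset_eq_degree]
    congr 1
    ext u
    simp
  rw [natCard_coloring_eq_card_listColorings, natCard_coloring_completeBipartiteGraph]
  set Z : ℝ := (bicliqueCount d d (Finset.univ : Finset (Fin q)) Finset.univ : ℝ) with hZ
  have hZ0 : 0 ≤ Z := Nat.cast_nonneg _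
  have hbound : colorBound G (fun _ => (Finset.univ : Finset (Fin q))) =
      Z ^ ((Fintype.card V : ℝ) / (2 * d)) := by
    have hiso : ∀ v, isolatedFactor G (fun _ => (Finset.univ : Finset (Fin q))) v = 1 := by
      intro v
      rw [isolatedFactor, if_neg]
      exact (Finset.card_pos.1 (by rw [hcard]; exact hd)).ne_empty
    have hedge : ∀ v u, √(edgeNorm G (fun _ => (Finset.univ : Finset (Fin q))) v u) =
        Z ^ (1 / (2 * (d : ℝ) ^ 2)) := by
      intro v u
      rw [edgeNorm, hcard, hcard, bicliqueNorm, Real.sqrt_eq_rpow, ← Real.rpow_mul hZ0]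
      congr 1
      field_simp
    simp only [colorBound, hiso, hedge, Finset.prod_const, hcard, one_pow, one_mul,
      Finset.card_univ]
    rw [← Real.rpow_natCast, ← Real.rpow_natCast, ← Real.rpow_mul hZ0, ← Real.rpow_mul hZ0]
    congr 1
    field_simp
  have h := card_listColorings_le_colorBound G (fun _ => (Finset.univ : Finset (Fin q)))
  rw [hbound] at h
  refine (Real.rpow_le_rpow (Nat.cast_nonneg _) h (by positivity)).trans (le_of_eq ?_)
  rw [← Real.rpow_mul hZ0]
  congr 1
  field_simp
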